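/- Let $K$ be a field and let $E$ be a directed graph with vertex set $E^0$, edge set $E^1$, and source and range maps $\mathbf s,\mathbf r:E^1\to E^0$ ($E^0$ and $E^1$ may be infinite, and vertices may emit infinitely many edges). A cycle is a closed path $e_1\cdots e_m$, $m\ge 1$, whose edges have pairwise different sources; a graph is acyclic if it has no cycles, and it consists of a single cycle if it has a cycle that contains all of its vertices and all of its edges. The Leavitt path algebra $L_K(E)$ is the associative (not necessarily unital) $K$-algebra generated by $E^0\cup E^1\cup\{e^*\mid e\in E^1\}$ subject to the following relations, for all $v,w\in E^0$ and $e,f\in E^1$: $vv=v$, and $vw=0$ if $v\ne w$; $\mathbf s(e)e=e\,\mathbf r(e)=e$; $\mathbf r(e)e^*=e^*\mathbf s(e)=e^*$; $e^*e=\mathbf r(e)$, and $e^*f=0$ if $e\ne f$; and $v=\sum_{\mathbf s(e)=v}ee^*$ whenever $v$ emits at least one and only finitely many edges. It is $\mathbb Z$-graded: $L_K(E)_n$ is the $K$-span of all $pq^*$, where $p,q$ are paths (vertices are paths of length $0$) with $|p|-|q|=n$; here $v^*=v$ for a vertex $v$ and $(e_1\cdots e_k)^*=e_k^*\cdots e_1^*$.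 A not necessarily unital ring $R=\bigoplus_{n\in\mathbb Z}R_n$ graded by $\mathbb Z$ is called graded exchange if for every homogeneous $x\in R$ 1. there is an idempotent $e\in R_0$ with $e\in xR$ and $e=x+y-xy$ for some $y\in R$, and 2. there is an idempotent $e\in R_0$ with $e\in Rx$ and $e=y+x-yx$ for some $y\in R$. (If $R$ is unital, the last condition in (1) says $1-e\in(1-x)R$, and the last condition in (2) says $1-e\in R(1-x)$.) **Proposition 4.7.** If $E$ is a disjoint union of graphs (an arbitrary family) each of which is either acyclic or consists of a single cycle, then $L_K(E)$ is graded exchange. -/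

import Mathlib

universe u v w u' v'

/-! ### Directed graphs -/

/-- A directed graph: vertices, edges, and the source and range maps.  Both sets may be infinite,
loops and parallel edges are allowed, and a vertex may emit infinitely many edges. -/
structure DirectedGraph : Type (max (u + 1) (v + 1)) where
  Vertex : Type u
  Edge : Type v
  src : Edge → Vertex
  rng : Edge → Vertex

namespace DirectedGraph

/-- A vertex is regular if it emits at least one and only finitely many edges. -/
def IsRegular (E : DirectedGraph.{u, v}) (x : E.Vertex) : Prop :=
  {e : E.Edge | E.src e = x}.Nonempty ∧ {e : E.Edge | E.src e = x}.Finite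

/-- `E.IsPath x p y`: the list of edges `p` is a path from `x` to `y`.  The empty list is the path
of length zero at a vertex. -/
def IsPath (E : DirectedGraph.{u, v}) : E.Vertex → List E.Edge → E.Vertex → Prop
  | x, [], y => x = y
  | x, e :: p, y => E.src e = x ∧ E.IsPath (E.rng e) p y

/-- A cycle (based at `x`): a closed path of positive length whose edges have pairwise different
sources. -/
def IsCycle (E : DirectedGraph.{u, v}) (x : E.Vertex) (c : List E.Edge) : Prop :=
  c ≠ [] ∧ E.IsPath x c x ∧ (c.map E.src).Nodup

/-- A graph without cycles. -/
def IsAcyclic (E : DirectedGraph.{u, v}) : Prop :=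
  ∀ (x : E.Vertex) (c : List E.Edge), ¬ E.IsCycle x c

/-- A graph consisting of a single cycle: some cycle contains all its vertices and all its
edges. -/
def IsSingleCycle (E : DirectedGraph.{u, v}) : Prop :=
  ∃ (x : E.Vertex) (c : List E.Edge), E.IsCycle x c ∧
    (∀ y : E.Vertex, y ∈ c.map E.src) ∧ ∀ e : E.Edge, e ∈ c

/-- The disjoint union of a family of graphs. -/
def disjointUnion {ι : Type w} (F : ι → DirectedGraph.{u, v}) :
    DirectedGraph.{max w u, max w v} where
  Vertex := Σ i, (F i).Vertex
  Edge := Σ i, (F i).Edge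
  src e := ⟨e.1, (F e.1).src e.2⟩
  rng e := ⟨e.1, (F e.1).rng e.2⟩

/-- An isomorphism of directed graphs. -/
structure Iso (E : DirectedGraph.{u, v}) (F : DirectedGraph.{u', v'}) where
  onVertex : E.Vertex ≃ F.Vertex
  onEdge : E.Edge ≃ F.Edge
  src_onEdge : ∀ e, F.src (onEdge e) = onVertex (E.src e)
  rng_onEdge : ∀ e, F.rng (onEdge e) = onVertex (E.rng e)

end DirectedGraph

/-! ### Leavitt path algebras -/

namespace LeavittPath

/-- The generators: vertices, edges, and ghost edges `e*`. -/
inductive Gen (E : DirectedGraph.{u, v}) : Type (max u v)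
  | vertex (x : E.Vertex) : Gen E
  | edge (e : E.Edge) : Gen E
  | ghost (e : E.Edge) : Gen E

variable (K : Type w) [Field K] (E : DirectedGraph.{u, v})

/-- The free associative, not necessarily unital, `K`-algebra on the generators: its basis is the
set of nonempty words in the generators. -/
abbrev FreeAlg : Type (max u v w) := MonoidAlgebra K (FreeSemigroup (Gen E))

variable {E}

/-- A generator as an element of the free algebra. -/
noncomputable def gen (g : Gen E) : FreeAlg K E := MonoidAlgebra.single (FreeSemigroup.of g) 1

variable (E)

/-- The defining relations (V), (E1), (E2), (CK1), (CK2). -/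
inductive Rel : FreeAlg K E → FreeAlg K E → Prop
  | vertex_mul_self (x : E.Vertex) :
      Rel (gen K (.vertex x) * gen K (.vertex x)) (gen K (.vertex x))
  | vertex_mul_of_ne (x y : E.Vertex) (h : x ≠ y) :
      Rel (gen K (.vertex x) * gen K (.vertex y)) 0
  | src_mul_edge (e : E.Edge) :
      Rel (gen K (.vertex (E.src e)) * gen K (.edge e)) (gen K (.edge e))
  | edge_mul_rng (e : E.Edge) :
      Rel (gen K (.edge e) * gen K (.vertex (E.rng e))) (gen K (.edge e))
  | rng_mul_ghost (e : E.Edge) :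
      Rel (gen K (.vertex (E.rng e)) * gen K (.ghost e)) (gen K (.ghost e))
  | ghost_mul_src (e : E.Edge) :
      Rel (gen K (.ghost e) * gen K (.vertex (E.src e))) (gen K (.ghost e))
  | ghost_mul_edge_self (e : E.Edge) :
      Rel (gen K (.ghost e) * gen K (.edge e)) (gen K (.vertex (E.rng e)))
  | ghost_mul_edge_of_ne (e f : E.Edge) (h : e ≠ f) :
      Rel (gen K (.ghost e) * gen K (.edge f)) 0
  | cuntz_krieger (x : E.Vertex) (h : E.IsRegular x) :
      Rel (gen K (.vertex x)) (∑ e ∈ h.2.toFinset, gen K (.edge e) * gen K (.ghost e))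

/-- The congruence of the free `K`-algebra generated by the relations: the smallest one, for
addition, multiplication and scalar multiplication, that contains them. -/
noncomputable def con : RingCon (FreeAlg K E) :=
  ringConGen fun a b => ∃ (k : K) (a' b' : FreeAlg K E), Rel K E a' b' ∧ a = k • a' ∧ b = k • b'

variable {K E}

theorem con_of_rel {a b : FreeAlg K E} (h : Rel K E a b) : con K E a b :=
  RingConGen.Rel.of _ _ ⟨1, a, b, h, (one_smul K a).symm, (one_smul K b).symm⟩

theorem con_smul (k : K) {a b : FreeAlg K E} (h : con K E a b) : con K E (k • a) (k • b) := by
  change RingConGen.Rel _ a b at h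
  induction h with
  | of a b h =>
    obtain ⟨l, a', b', h, rfl, rfl⟩ := h
    exact RingConGen.Rel.of _ _ ⟨k * l, a', b', h, smul_smul .., smul_smul ..⟩
  | refl a => exact (con K E).refl _
  | symm _ ih => exact (con K E).symm ih
  | trans _ _ ih₁ ih₂ => exact (con K E).trans ih₁ ih₂
  | add _ _ ih₁ ih₂ => rw [smul_add, smul_add]; exact (con K E).add ih₁ ih₂
  | mul _ h₂ ih₁ _ => rw [← smul_mul_assoc, ← smul_mul_assoc]; exact (con K E).mul ih₁ h₂

end LeavittPath

open LeavittPath in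
/-- The Leavitt path algebra `L_K(E)`: the associative `K`-algebra (unital only if `E` has finitely
many vertices) presented by the vertices, the edges and the ghost edges of `E`, and the relations
(V), (E1), (E2), (CK1), (CK2). -/
def LeavittPathAlgebra (K : Type w) [Field K] (E : DirectedGraph.{u, v}) : Type (max u v w) :=
  (con K E).Quotient

namespace LeavittPathAlgebra

open LeavittPath

variable (K : Type w) [Field K] {E : DirectedGraph.{u, v}}

noncomputable instance : NonUnitalRing (LeavittPathAlgebra K E) :=
  inferInstanceAs (NonUnitalRing (con K E).Quotient)

/-- The quotient map from the free algebra. -/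
noncomputable def mk : FreeAlg K E →+ LeavittPathAlgebra K E where
  toFun a := (a : (con K E).Quotient)
  map_zero' := rfl
  map_add' _ _ := rfl

theorem mk_surjective : Function.Surjective (mk K (E := E)) := Quotient.mk''_surjective

theorem mk_mul (a b : FreeAlg K E) : mk K (a * b) = mk K a * mk K b := rfl

theorem mk_eq_of_rel {a b : FreeAlg K E} (h : Rel K E a b) : mk K a = mk K b :=
  Quotient.sound (con_of_rel h)

noncomputable instance : SMul K (LeavittPathAlgebra K E) where
  smul k := Quotient.map (k • ·) fun _ _ h => con_smul k h

theorem mk_smul (k : K) (a : FreeAlg K E) : mk K (k • a) = k • mk K a := rfl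

noncomputable instance : Module K (LeavittPathAlgebra K E) :=
  Function.Surjective.module K (mk K) (mk_surjective K) (mk_smul K)

instance : IsScalarTower K (LeavittPathAlgebra K E) (LeavittPathAlgebra K E) where
  smul_assoc k a b := by
    obtain ⟨a, rfl⟩ := mk_surjective K a
    obtain ⟨b, rfl⟩ := mk_surjective K b
    simp only [smul_eq_mul, ← mk_smul, ← mk_mul, smul_mul_assoc]

instance : SMulCommClass K (LeavittPathAlgebra K E) (LeavittPathAlgebra K E) where
  smul_comm k a b := by
    obtain ⟨a, rfl⟩ := mk_surjective K a
    obtain ⟨b, rfl⟩ := mk_surjective K b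
    simp only [smul_eq_mul, ← mk_smul, ← mk_mul, mul_smul_comm]

/-- The generators of the Leavitt path algebra. -/
noncomputable def vertex (x : E.Vertex) : LeavittPathAlgebra K E := mk K (gen K (.vertex x))

noncomputable def edge (e : E.Edge) : LeavittPathAlgebra K E := mk K (gen K (.edge e))

noncomputable def ghost (e : E.Edge) : LeavittPathAlgebra K E := mk K (gen K (.ghost e))

/-- The element `e₁ ⋯ eₙ` of the algebra given by a path that starts at `x` (it is `x` itself if
the path has length zero; the last factor `r(eₙ)` that the recursion adds is absorbed by `eₙ`). -/
noncomputable def path : E.Vertex → List E.Edge → LeavittPathAlgebra K E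
  | x, [] => vertex K x
  | _, e :: p => edge K e * path (E.rng e) p

/-- The element `eₙ* ⋯ e₁*` given by a path `e₁ ⋯ eₙ` that starts at `x` (again `x` itself for
length zero). -/
noncomputable def pathStar : E.Vertex → List E.Edge → LeavittPathAlgebra K E
  | x, [] => vertex K x
  | _, e :: p => pathStar (E.rng e) p * ghost K e

variable (E)

/-- The natural `ℤ`-grading: the `n`-component is the `K`-span of all `p q*` with `|p| - |q| = n`.
Only paths with a common range `z` are listed, because `p q* = 0` for all others. -/
noncomputable def component (n : ℤ) : Submodule K (LeavittPathAlgebra K E) :=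
  Submodule.span K {a | ∃ (x y z : E.Vertex) (p q : List E.Edge),
    E.IsPath x p z ∧ E.IsPath y q z ∧ (p.length : ℤ) - (q.length : ℤ) = n ∧
      a = path K x p * pathStar K y q}

end LeavittPathAlgebra

/-! ### Graded exchange rings -/

section GradedExchange

variable {Γ : Type u} {R : Type v} {σ : Type w} [AddGroup Γ] [NonUnitalRing R] [SetLike σ R]

/-- A (not necessarily unital) ring `R`, graded by `𝒜`, is graded right exchange if for every
homogeneous `x` there is a homogeneous idempotent `e`, necessarily of degree `0`, such that
`e ∈ x R` and `e ∈ x ∘ R`, where `x ∘ y = x + y - x y`.  If `R` is unital, `e ∈ x ∘ R` means that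
`1 - e ∈ (1 - x) R`. -/
def IsGradedRightExchange (𝒜 : Γ → σ) : Prop :=
  ∀ (γ : Γ) (x : R), x ∈ 𝒜 γ → ∃ e : R, e ∈ 𝒜 0 ∧ e * e = e ∧
    (∃ r : R, e = x * r) ∧ ∃ y : R, e = x + y - x * y

/-- The left-hand version: `e ∈ R x` and `e ∈ R ∘ x`. -/
def IsGradedLeftExchange (𝒜 : Γ → σ) : Prop :=
  ∀ (γ : Γ) (x : R), x ∈ 𝒜 γ → ∃ e : R, e ∈ 𝒜 0 ∧ e * e = e ∧
    (∃ r : R, e = r * x) ∧ ∃ y : R, e = y + x - y * x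

/-- Graded exchange: both graded right exchange and graded left exchange. -/
def IsGradedExchange (𝒜 : Γ → σ) : Prop :=
  IsGradedRightExchange 𝒜 ∧ IsGradedLeftExchange 𝒜

end GradedExchange

/-! The key is that every homogeneous `x` is Drazin invertible in the unitization, with spectral
idempotent of degree `0`: there is `d` with `x d = d x = e`, `d e = d`, and `n = x - x e` nilpotent.
This suffices for exchange. The idempotent `e` lies in `x R` and `R x`, while on the complement `1 -
e` the element `1 - x` acts as the unit `1 - n`, so `1 - e` is a right and a left multiple of `1 -
x`.

Elements supported on different graphs of the union annihilate each other, and Drazin invertibility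
passes to orthogonal sums, so `x` may be supported on a single graph. The criterion there is
`IsDrazinIn.of_finiteDimensional`: some `x ^ m`, corrected by a unit commuting with `x`, has all its
positive powers in a finite-dimensional space.

On an acyclic graph, the finitely many edges occurring in `x` form only paths of bounded length. In
degree `0` the powers of `x` therefore stay in a finite-dimensional space; in degree `n ≠ 0` they
eventually exceed every available degree, so `x` is nilpotent.

On a single cycle, (CK2) turns the sum of the edges into a unit `g` that permutes the vertices, and
the degree `n` elements are those of `D g ^ n`, with `D` the span of the vertices. If `N` is the
order of the permutation, then `g ^ (n N)` commutes with `D`, and `x ^ N g ^ (-n N)` lies in the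
finite-dimensional algebra `D`. -/

/-! ### Drazin invertible elements -/

section Drazin

variable {K : Type*} [Field K] {A : Type*} [Ring A] [Algebra K A]

/-- An element `x` is Drazin invertible relative to a subspace `W` if it has a Drazin inverse `d`
whose associated idempotent `x d = d x` lies in `W`. -/
def IsDrazinIn (W : Submodule K A) (x : A) : Prop :=
  ∃ d e : A, e ∈ W ∧ x * d = e ∧ d * x = e ∧ d * e = d ∧ IsNilpotent (x - x * e)

theorem IsDrazinIn.of_isNilpotent {W : Submodule K A} {x : A} (hx : IsNilpotent x) :
    IsDrazinIn W x :=
  ⟨0, 0, W.zero_mem, by simp, by simp, by simp, by simpa using hx⟩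

/-- Since `d` and `e` are two-sided multiples of `x`, orthogonality of `x` and `y` makes all mixed
products vanish, so `d + d'` works with idempotent `e + e'`. -/
theorem IsDrazinIn.add {W : Submodule K A} {x y : A} (hx : IsDrazinIn W x)
    (hy : IsDrazinIn W y) (hxy : x * y = 0) (hyx : y * x = 0) : IsDrazinIn W (x + y) := by
  obtain ⟨d, e, he, hxd, hdx, hde, hn⟩ := hx
  obtain ⟨d', e', he', hxd', hdx', hde', hn'⟩ := hy
  have hed : e * d = d := by rw [← hdx, mul_assoc, hxd, hde]
  have hed' : e' * d' = d' := by rw [← hdx', mul_assoc, hxd', hde']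
  have hey : e * y = 0 := by rw [← hdx, mul_assoc, hxy, mul_zero]
  have he'x : e' * x = 0 := by rw [← hdx', mul_assoc, hyx, mul_zero]
  have hye : y * e = 0 := by rw [← hxd, ← mul_assoc, hyx, zero_mul]
  have hxe' : x * e' = 0 := by rw [← hxd', ← mul_assoc, hxy, zero_mul]
  have hdy : d * y = 0 := by rw [← hde, mul_assoc, hey, mul_zero]
  have hd'x : d' * x = 0 := by rw [← hde', mul_assoc, he'x, mul_zero]
  have hyd : y * d = 0 := by rw [← hed, ← mul_assoc, hye, zero_mul]
  have hxd'' : x * d' = 0 := by rw [← hed', ← mul_assoc, hxe', zero_mul]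
  have hde'' : d * e' = 0 := by rw [← hxd', ← mul_assoc, hdy, zero_mul]
  have hd'e : d' * e = 0 := by rw [← hxd, ← mul_assoc, hd'x, zero_mul]
  refine ⟨d + d', e + e', W.add_mem he he', ?_, ?_, ?_, ?_⟩
  · simp [mul_add, add_mul, hxd, hxd', hyd, hxd'']
  · simp [mul_add, add_mul, hdx, hdx', hdy, hd'x]
  · simp [mul_add, add_mul, hde, hde', hde'', hd'e]
  · have h : x + y - (x + y) * (e + e') = (x - x * e) + (y - y * e') := by
      simp only [mul_add, add_mul, hye, hxe']; abel
    rw [h]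
    refine Commute.isNilpotent_add ?_ hn hn'
    have h1 : (x - x * e) * (y - y * e') = 0 := by
      simp [mul_sub, sub_mul, mul_assoc, hxy, hey, ← mul_assoc e y, ← mul_assoc x y]
    have h2 : (y - y * e') * (x - x * e) = 0 := by
      simp [mul_sub, sub_mul, mul_assoc, hyx, he'x, ← mul_assoc e' x, ← mul_assoc y x]
    exact h1.trans h2.symm

theorem IsDrazinIn.sum {ι : Type*} {W : Submodule K A} (s : Finset ι) (f : ι → A)
    (hf : ∀ i ∈ s, IsDrazinIn W (f i)) (h : ∀ i ∈ s, ∀ j ∈ s, i ≠ j → f i * f j = 0) :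
    IsDrazinIn W (∑ i ∈ s, f i) := by
  classical
  induction s using Finset.induction_on with
  | empty => exact .of_isNilpotent (by simp)
  | insert a s ha ih =>
    rw [Finset.sum_insert ha]
    refine (hf a (by simp)).add (ih (fun i hi => hf i (by simp [hi]))
      fun i hi j hj => h i (by simp [hi]) j (by simp [hj])) ?_ ?_
    · rw [Finset.mul_sum]
      exact Finset.sum_eq_zero fun j hj => h a (by simp) j (by simp [hj]) (by grind)
    · rw [Finset.sum_mul]
      exact Finset.sum_eq_zero fun j hj => h j (by simp [hj]) a (by simp) (by grind)

/-- A unital form of the right and left exchange conditions. -/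
theorem IsDrazinIn.exists_exchange {W : Submodule K A} {x : A} (hx : IsDrazinIn W x) :
    ∃ e ∈ W, e * e = e ∧ ∃ d y : A, d * e = d ∧ e = x * d ∧ e = d * x ∧
      e = x + y - x * y ∧ e = y + x - y * x := by
  obtain ⟨d, e, he, hxd, hdx, hde, N, hN⟩ := hx
  have hee : e * e = e := by nth_rw 1 [← hxd]; rw [mul_assoc, hde, hxd]
  have hxe : e * x = x * e := by rw [← hxd, mul_assoc, hdx, hxd]
  set n := x - x * e with hn
  have hne : n * e = 0 := by rw [hn, sub_mul, mul_assoc, hee, sub_self]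
  have hen : e * n = 0 := by rw [hn, mul_sub, ← mul_assoc, hxe, mul_assoc, hee, sub_self]
  have hg₁ : (1 - n) * ∑ i ∈ Finset.range N, n ^ i = 1 := by
    rw [mul_neg_geom_sum, hN, sub_zero]
  have hg₂ : (∑ i ∈ Finset.range N, n ^ i) * (1 - n) = 1 := by
    rw [geom_sum_mul_neg, hN, sub_zero]
  set s := ∑ i ∈ Finset.range N, n ^ i
  have hcomm : Commute s (1 - e) :=
    Commute.sum_left _ _ _ fun i _ => Commute.pow_left
      (show n * (1 - e) = (1 - e) * n by rw [mul_sub n, sub_mul _ _ n, hne, hen, mul_one, one_mul]) i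
  have h1 : (1 - x) * (1 - e) = (1 - n) * (1 - e) := by
    simp only [hn, mul_sub, sub_mul, mul_assoc, hee, one_mul, mul_one]; abel
  have h2 : (1 - e) * (1 - x) = (1 - e) * (1 - n) := by
    simp only [hn, mul_sub, sub_mul, ← mul_assoc, hxe, one_mul, mul_one]
    simp only [mul_assoc, hee]; abel
  -- Here `s = (1 - n)⁻¹` commutes with `e`, and `y` is chosen so that `1 - y = (1 - e) s` is an
  -- inverse of `1 - x` relative to `1 - e`, on both sides.
  refine ⟨e, he, hee, d, 1 - (1 - e) * s, hde, hxd.symm, hdx.symm, ?_, ?_⟩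
  · have : (1 - x) * ((1 - e) * s) = 1 - e := by
      rw [← mul_assoc, h1, mul_assoc, ← hcomm.eq, ← mul_assoc, hg₁, one_mul]
    calc e = 1 - (1 - x) * ((1 - e) * s) := by rw [this, sub_sub_cancel]
      _ = _ := by noncomm_ring
  · have : ((1 - e) * s) * (1 - x) = 1 - e := by
      rw [← hcomm.eq, mul_assoc, h2, ← mul_assoc, hcomm.eq, mul_assoc, hg₂,
        mul_one]
    calc e = 1 - ((1 - e) * s) * (1 - x) := by rw [this, sub_sub_cancel]
      _ = _ := by noncomm_ring

open Polynomial in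
/-- If the positive powers of `z` span a finite-dimensional space, a power of `z` is divisible by
a higher power within the polynomials in `z`. -/
theorem exists_pow_eq_pow_succ_mul_aeval {V : Submodule K A} [FiniteDimensional K V] {z : A}
    (hz : ∀ k, z ^ (k + 1) ∈ V) : ∃ (k : ℕ) (r : K[X]), z ^ k = z ^ (k + 1) * aeval z r := by
  have hlin : ¬ LinearIndependent K fun k : ℕ => (⟨z ^ (k + 1), hz k⟩ : V) := fun h =>
    not_finite_iff_infinite.2 inferInstance (h.finite)
  have hinj : ∃ p : K[X], p ≠ 0 ∧ aeval z p = 0 := by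
    by_contra! hp
    apply hlin
    rw [linearIndependent_iff']
    intro s g hg i hi
    have h : aeval z (∑ k ∈ s, C (g k) * X ^ (k + 1)) = 0 := by
      have := congrArg Subtype.val hg
      simpa [Algebra.smul_def] using this
    have h0 : ∑ k ∈ s, C (g k) * X ^ (k + 1) = (0 : K[X]) := by
      by_contra h'; exact hp _ h' h
    have := congrArg (fun p => coeff p (i + 1)) h0
    simpa [finsetSum_coeff, coeff_C_mul, coeff_X_pow, hi] using this
  obtain ⟨p, hp, hpz⟩ := hinj
  -- Write the annihilating polynomial as `X ^ k * q` with `q(0) ≠ 0`. Then `1` is a multiple of `q`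
  -- plus a multiple of `X`, and `z ^ k` kills the first summand.
  obtain ⟨q, hq, hqX⟩ := exists_eq_pow_rootMultiplicity_mul_and_not_dvd p hp 0
  rw [C_0, sub_zero, X_dvd_iff] at hqX
  rw [C_0, sub_zero] at hq
  set k := rootMultiplicity 0 p
  refine ⟨k, -C (q.coeff 0)⁻¹ * divX q, ?_⟩
  have h : z ^ k * aeval z q = 0 := by rw [← hpz, hq]; simp
  have hq' : (1 : K[X]) = C (q.coeff 0)⁻¹ * q + X * (-C (q.coeff 0)⁻¹ * divX q) := by
    nth_rw 2 [← X_mul_divX_add q]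
    have : C (q.coeff 0)⁻¹ * C (q.coeff 0) = (1 : K[X]) := by
      rw [← C_mul, inv_mul_cancel₀ hqX, C_1]
    linear_combination -this
  calc z ^ k = z ^ k * aeval z (1 : K[X]) := by simp
    _ = z ^ k * (aeval z q * aeval z (C (q.coeff 0)⁻¹)) +
        z ^ (k + 1) * aeval z (-C (q.coeff 0)⁻¹ * divX q) := by
      rw [hq', map_add, mul_add, mul_comm (C _) q, map_mul, map_mul _ X, aeval_X, pow_succ,
        mul_assoc (z ^ k) z]
    _ = _ := by rw [← mul_assoc, h, zero_mul, zero_add]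

open Polynomial in
-- `V` need not contain `1`, so only polynomials in `z` without constant term are sure to lie in it.
theorem mul_aeval_mem {V : Submodule K A} {z : A} (hz : ∀ k, z ^ (k + 1) ∈ V) (p : K[X]) :
    z * aeval z p ∈ V := by
  induction p using Polynomial.induction_on' with
  | add p q hp hq => rw [map_add, mul_add]; exact V.add_mem hp hq
  | monomial n a =>
    rw [aeval_monomial, ← Algebra.smul_def, mul_smul_comm, ← pow_succ']
    exact V.smul_mem _ (hz n)

open Polynomial in
-- The powers of `x` itself may span an infinite-dimensional space; the unit `g` brings a power of
-- `x` back into `V`. The idempotent is built from `z = x ^ m * g` and serves for `x`, because `g`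
-- is invertible and commutes with `x`.
theorem IsDrazinIn.of_finiteDimensional {V : Submodule K A} [FiniteDimensional K V] {x : A}
    (g : Aˣ) (hg : Commute x g) (m : ℕ) (hm : m ≠ 0) (hz : ∀ k, (x ^ m * g) ^ (k + 1) ∈ V) :
    IsDrazinIn V x := by
  obtain ⟨m, rfl⟩ := Nat.exists_eq_succ_of_ne_zero hm
  set z := x ^ (m + 1) * g with hzdef
  obtain ⟨k, r, hk⟩ := exists_pow_eq_pow_succ_mul_aeval hz
  have hcomm (p q : K[X]) : aeval z p * aeval z q = aeval z q * aeval z p := by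
    rw [← map_mul, mul_comm, map_mul]
  set t : K[X] := X * r
  have hk1 : z ^ k = z ^ k * aeval z t := by
    rw [map_mul, aeval_X, ← mul_assoc, ← pow_succ]; exact hk
  have hkj (j : ℕ) : z ^ k = z ^ k * aeval z t ^ j := by
    induction j with
    | zero => simp
    | succ j ih => rw [pow_succ, ← mul_assoc, ← ih, ← hk1]
  -- With this choice `X * s = t ^ (k + 1)`, so `e = z * s(z)` is divisible by `z ^ k` and fixes `z
  -- ^ k`; hence it is idempotent.
  set s : K[X] := X ^ k * r ^ (k + 1)
  set e := aeval z (X * s) with he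
  have het : e = aeval z t ^ (k + 1) := by
    rw [he, ← map_pow]; congr 1; simp only [s, t]; ring
  have hez : e = z ^ k * aeval z (X * r ^ (k + 1)) := by
    rw [he, show X * s = X ^ k * (X * r ^ (k + 1)) by simp only [s]; ring, map_mul]; simp
  have hzke : z ^ k * e = z ^ k := by rw [het, ← hkj]
  have hee : e * e = e := by
    nth_rw 1 [hez]
    rw [mul_assoc, he, hcomm, ← he, ← mul_assoc, hzke, ← hez]
  have hxz : Commute x z := ((Commute.refl x).pow_right _).mul_right hg
  have hxp (p : K[X]) : Commute x (aeval z p) := by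
    induction p using Polynomial.induction_on' with
    | add p q hp hq => rw [map_add]; exact hp.add_right hq
    | monomial n a =>
      rw [aeval_monomial]; exact Commute.mul_right (Algebra.commutes a x).symm (hxz.pow_right n)
  have hzs : z * aeval z s = e := by
    rw [he, map_mul _ X, aeval_X]
  set d := x ^ m * g * aeval z s * e with hd
  have hxd : x * d = e := by
    rw [hd, ← mul_assoc, ← mul_assoc, ← mul_assoc, ← pow_succ', ← hzdef, hzs, hee]
  have hxdc : Commute x d :=
    ((((Commute.refl x).pow_right _).mul_right hg).mul_right (hxp s)).mul_right (hxp _)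
  -- The factor is `k + 1`, not `k`, so that the exponent is positive even for `k = 0`, as `(1 - e)
  -- ^ N = 1 - e` requires.
  refine ⟨d, e, ?_, hxd, by rw [← hxdc.eq, hxd], by rw [hd, mul_assoc, hee], (m + 1) * (k + 1), ?_⟩
  · rw [← hzs]; exact mul_aeval_mem hz s
  · have hgz : Commute (x ^ (m + 1)) (g : A) := hg.pow_left _
    have h1 : x - x * e = x * (1 - e) := by rw [mul_sub, mul_one]
    have hce : Commute x (1 - e) := (Commute.one_right x).sub_right (hxp _)
    have hidem : IsIdempotentElem (1 - e) := IsIdempotentElem.one_sub hee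
    rw [h1, hce.mul_pow, hidem.pow_eq (by simp)]
    have h2 : x ^ ((m + 1) * (k + 1)) = z ^ (k + 1) * ((g⁻¹ : Aˣ) : A) ^ (k + 1) := by
      have : z ^ (k + 1) = x ^ ((m + 1) * (k + 1)) * (g : A) ^ (k + 1) := by
        rw [hzdef, hgz.mul_pow, pow_mul]
      rw [this, mul_assoc, ← Units.val_pow_eq_pow_val, ← Units.val_pow_eq_pow_val, ← Units.val_mul]
      simp
    have h3 : Commute z ((g⁻¹ : Aˣ) : A) :=
      Commute.units_inv_right (hgz.mul_left (Commute.refl _))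
    have h5 : Commute (e) ((g⁻¹ : Aˣ) : A) := by
      have (p : K[X]) : Commute (aeval z p) ((g⁻¹ : Aˣ) : A) := by
        induction p using Polynomial.induction_on' with
        | add p q hp hq => rw [map_add]; exact hp.add_left hq
        | monomial n a =>
          rw [aeval_monomial]; exact Commute.mul_left (Algebra.commutes a _) (h3.pow_left n)
      exact this _
    rw [h2, mul_assoc, (((Commute.one_left _).sub_left h5).pow_right _).eq.symm, ← mul_assoc,
      pow_succ', mul_assoc z, mul_sub, hzke, mul_one, sub_self, mul_zero, zero_mul]

theorem IsDrazinIn.mono {V W : Submodule K A} (h : V ≤ W) {x : A} (hx : IsDrazinIn V x) :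
    IsDrazinIn W x := by
  obtain ⟨d, e, he, h'⟩ := hx
  exact ⟨d, e, h he, h'⟩

end Drazin

/-! ### From Drazin invertibility to graded exchange -/

/-- A graded algebra all of whose homogeneous elements are Drazin invertible, with idempotents of
degree `0`, is graded exchange. -/
theorem isGradedExchange_of_isDrazinIn {K : Type*} [Field K] {R : Type*} [NonUnitalRing R]
    [Module K R] [IsScalarTower K R R] [SMulCommClass K R R] {Γ : Type*} [AddGroup Γ]
    (𝒜 : Γ → Submodule K R)
    (h : ∀ γ, ∀ x ∈ 𝒜 γ, IsDrazinIn ((𝒜 0).map (Unitization.inrHom K K R)) (x : Unitization K R)) :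
    IsGradedExchange 𝒜 := by
  have key : ∀ γ, ∀ x ∈ 𝒜 γ, ∃ e ∈ 𝒜 0, e * e = e ∧ ∃ d y z : R, e = x * d ∧ e = d * x ∧
      e = x + y - x * y ∧ e = z + x - z * x := by
    intro γ x hx
    obtain ⟨_, ⟨e, he, rfl⟩, hee, d, y, hde, hxd, hdx, hy, hy'⟩ :=
      (h γ x hx).exists_exchange
    simp only [Unitization.inrHom_apply] at *
    have hinr (a : Unitization K R) (ha : a.fst = 0) : a = (a.snd : Unitization K R) := by
      ext <;> simp [ha]
    -- `R` is an ideal of its unitization, so `d = d e` lies in it; `y` does too, by comparing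
    -- scalar parts in `e = x + y - x y`.
    have hd := hinr d (by rw [← hde]; simp)
    have hyy := hinr y (by
      have := congrArg (Unitization.fstHom K R) hy
      rw [map_sub, map_add, map_mul] at this
      simpa using this.symm)
    rw [hyy] at hy hy'
    rw [hd] at hxd hdx
    have hi := Unitization.inr_injective (R := K) (A := R)
    refine ⟨e, he, hi (by simpa using hee), d.snd, y.snd, y.snd, hi ?_, hi ?_, hi ?_, hi ?_⟩
    · simpa using hxd
    · simpa using hdx
    · simpa [Unitization.inr_sub] using hy
    · simpa [Unitization.inr_sub] using hy'
  refine ⟨fun γ x hx => ?_, fun γ x hx => ?_⟩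
  · obtain ⟨e, he, hee, d, y, z, h1, h2, h3, h4⟩ := key γ x hx
    exact ⟨e, he, hee, ⟨d, h1⟩, y, h3⟩
  · obtain ⟨e, he, hee, d, y, z, h1, h2, h3, h4⟩ := key γ x hx
    exact ⟨e, he, hee, ⟨d, h2⟩, z, h4⟩

/-! ### Monomials of Leavitt path algebras -/

namespace DirectedGraph

variable {E : DirectedGraph.{u, v}}

theorem IsPath.append {x y z : E.Vertex} {p q : List E.Edge} (hp : E.IsPath x p y)
    (hq : E.IsPath y q z) : E.IsPath x (p ++ q) z := by
  induction p generalizing x with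
  | nil => obtain rfl : x = y := hp; exact hq
  | cons e p ih => exact ⟨hp.1, ih hp.2⟩

theorem IsPath.exists_of_append {x z : E.Vertex} {p q : List E.Edge}
    (h : E.IsPath x (p ++ q) z) : ∃ y, E.IsPath x p y ∧ E.IsPath y q z := by
  induction p generalizing x with
  | nil => exact ⟨x, rfl, h⟩
  | cons e p ih =>
    obtain ⟨y, h1, h2⟩ := ih h.2
    exact ⟨y, ⟨h.1, h1⟩, h2⟩

/-- Below a vertex from which no cycle can be reached, paths visit no vertex twice. -/
theorem IsPath.nodup_map_src {P : E.Vertex → Prop} (hP : ∀ e, P (E.src e) → P (E.rng e))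
    (hc : ∀ x c, P x → ¬ E.IsCycle x c) {x y : E.Vertex} {p : List E.Edge} (hx : P x)
    (hp : E.IsPath x p y) : (p.map E.src).Nodup := by
  induction p generalizing x with
  | nil => simp
  | cons e p ih =>
    obtain ⟨rfl, hp⟩ := hp
    have hnd := ih (hP e hx) hp
    rw [List.map_cons, List.nodup_cons]
    refine ⟨fun hmem => ?_, hnd⟩
    obtain ⟨f, hf, hfe⟩ := List.mem_map.1 hmem
    obtain ⟨a, b, rfl⟩ := List.append_of_mem hf
    obtain ⟨z, ha, hb⟩ := hp.exists_of_append
    -- The piece up to the repeated source is closed, and its sources are distinct because those of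
    -- the tail are.
    refine hc _ (e :: a) hx ⟨by simp, ⟨rfl, ?_⟩, ?_⟩
    · rw [← hfe, hb.1]; exact ha
    · rw [List.map_append, List.map_cons, List.nodup_append] at hnd
      rw [List.map_cons, List.nodup_cons]
      refine ⟨fun h => hnd.2.2 _ h _ (by simp) hfe.symm, hnd.1⟩

end DirectedGraph

namespace LeavittPathAlgebra

open LeavittPath

variable (K : Type w) [Field K] {E : DirectedGraph.{u, v}}

theorem vertex_mul_self (x : E.Vertex) : vertex K x * vertex K x = vertex K x :=
  mk_eq_of_rel K (.vertex_mul_self x)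

theorem vertex_mul_of_ne {x y : E.Vertex} (h : x ≠ y) : vertex K x * vertex K y = 0 :=
  mk_eq_of_rel K (.vertex_mul_of_ne x y h)

theorem src_mul_edge (e : E.Edge) : vertex K (E.src e) * edge K e = edge K e :=
  mk_eq_of_rel K (.src_mul_edge e)

theorem edge_mul_rng (e : E.Edge) : edge K e * vertex K (E.rng e) = edge K e :=
  mk_eq_of_rel K (.edge_mul_rng e)

theorem rng_mul_ghost (e : E.Edge) : vertex K (E.rng e) * ghost K e = ghost K e :=
  mk_eq_of_rel K (.rng_mul_ghost e)

theorem ghost_mul_src (e : E.Edge) : ghost K e * vertex K (E.src e) = ghost K e :=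
  mk_eq_of_rel K (.ghost_mul_src e)

theorem ghost_mul_edge_self (e : E.Edge) : ghost K e * edge K e = vertex K (E.rng e) :=
  mk_eq_of_rel K (.ghost_mul_edge_self e)

theorem ghost_mul_edge_of_ne {e f : E.Edge} (h : e ≠ f) : ghost K e * edge K f = 0 :=
  mk_eq_of_rel K (.ghost_mul_edge_of_ne e f h)

/-- The relation (CK2) at a vertex that emits a single edge. -/
theorem edge_mul_ghost_of_unique (e : E.Edge) (h : ∀ f, E.src f = E.src e → f = e) :
    edge K e * ghost K e = vertex K (E.src e) := by
  have hset : {f : E.Edge | E.src f = E.src e} = {e} := by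
    ext f; exact ⟨h f, fun hf => by rw [show f = e from hf]; rfl⟩
  have hreg : E.IsRegular (E.src e) := by
    rw [DirectedGraph.IsRegular, hset]; exact ⟨Set.singleton_nonempty e, Set.finite_singleton e⟩
  have := mk_eq_of_rel K (.cuntz_krieger _ hreg)
  have hfin : hreg.2.toFinset = {e} := by
    ext f; simpa using Set.ext_iff.1 hset f
  rw [hfin, Finset.sum_singleton, mk_mul] at this
  exact this.symm

theorem vertex_mul_path {x y : E.Vertex} {p : List E.Edge} (hp : E.IsPath x p y) :
    vertex K x * path K x p = path K x p := by
  cases p with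
  | nil => exact vertex_mul_self K x
  | cons e p => obtain ⟨rfl, -⟩ := hp; rw [path, ← mul_assoc, src_mul_edge]

theorem pathStar_mul_vertex {x y : E.Vertex} {p : List E.Edge} (hp : E.IsPath x p y) :
    pathStar K x p * vertex K x = pathStar K x p := by
  cases p with
  | nil => exact vertex_mul_self K x
  | cons e p => obtain ⟨rfl, -⟩ := hp; rw [pathStar, mul_assoc, ghost_mul_src]

theorem path_mul_path {x y z : E.Vertex} {p q : List E.Edge} (hp : E.IsPath x p y)
    (hq : E.IsPath y q z) : path K x p * path K y q = path K x (p ++ q) := by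
  induction p generalizing x with
  | nil => obtain rfl : x = y := hp; exact vertex_mul_path K hq
  | cons e p ih => rw [path, mul_assoc, ih hp.2]; rfl

theorem pathStar_mul_pathStar {x y z : E.Vertex} {p q : List E.Edge} (hp : E.IsPath x p y)
    (hq : E.IsPath y q z) : pathStar K y q * pathStar K x p = pathStar K x (p ++ q) := by
  induction p generalizing x with
  | nil => obtain rfl : x = y := hp; exact pathStar_mul_vertex K hq
  | cons e p ih => rw [pathStar, ← mul_assoc, ih hp.2]; rfl

theorem pathStar_mul_path_of_ne {x y x' y' : E.Vertex} {p q : List E.Edge}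
    (hq : E.IsPath x q y) (hp : E.IsPath x' p y') (h : x ≠ x') :
    pathStar K x q * path K x' p = 0 := by
  rw [← pathStar_mul_vertex K hq, ← vertex_mul_path K hp, mul_assoc, ← mul_assoc (vertex K x),
    vertex_mul_of_ne K h, zero_mul, mul_zero]

/-- First edges cancel or annihilate in pairs by (CK1), so `q* p` survives only if one path is an
initial segment of the other. -/
theorem pathStar_mul_path {x y x' y' : E.Vertex} {p q : List E.Edge}
    (hq : E.IsPath x q y) (hp : E.IsPath x' p y') :
    pathStar K x q * path K x' p = 0 ∨
    (∃ s, p = q ++ s ∧ E.IsPath y s y' ∧ pathStar K x q * path K x' p = path K y s) ∨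
    ∃ s, q = p ++ s ∧ E.IsPath y' s y ∧ pathStar K x q * path K x' p = pathStar K y' s := by
  by_cases hxx : x = x'
  swap
  · exact .inl (pathStar_mul_path_of_ne K hq hp hxx)
  subst hxx
  induction q generalizing x p with
  | nil =>
    obtain rfl : x = y := hq
    exact .inr (.inl ⟨p, rfl, hp, vertex_mul_path K hp⟩)
  | cons e q ih =>
    cases p with
    | nil =>
      obtain rfl : x = y' := hp
      exact .inr (.inr ⟨e :: q, rfl, hq, pathStar_mul_vertex K hq⟩)
    | cons f p =>
      have hmul : pathStar K x (e :: q) * path K x (f :: p) =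
          pathStar K (E.rng e) q * (ghost K e * edge K f) * path K (E.rng f) p := by
        simp only [path, pathStar, mul_assoc]
      rw [hmul]
      by_cases hef : e = f
      · subst hef
        rw [ghost_mul_edge_self, pathStar_mul_vertex K hq.2]
        rcases ih hq.2 hp.2 with h | ⟨s, rfl, h⟩ | ⟨s, rfl, h⟩
        · exact .inl h
        · exact .inr (.inl ⟨s, rfl, h⟩)
        · exact .inr (.inr ⟨s, rfl, h⟩)
      · left; rw [ghost_mul_edge_of_ne K hef, mul_zero, zero_mul]

variable {K} in
theorem vertex_mem_component (x : E.Vertex) : vertex K x ∈ component K E 0 :=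
  Submodule.subset_span ⟨x, x, x, [], [], rfl, rfl, by simp, (vertex_mul_self K x).symm⟩

/-! ### Local components -/

/-- The span of the monomials `p q*` of degree `n` whose vertices satisfy `P` at the two ends, and
whose paths satisfy `Q`. -/
noncomputable def localComponent (P : E.Vertex → Prop) (Q : List E.Edge → Prop) (n : ℤ) :
    Submodule K (LeavittPathAlgebra K E) :=
  Submodule.span K {a | ∃ (x y z : E.Vertex) (p q : List E.Edge), P x ∧ P y ∧ Q p ∧ Q q ∧
    E.IsPath x p z ∧ E.IsPath y q z ∧ (p.length : ℤ) - (q.length : ℤ) = n ∧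
      a = path K x p * pathStar K y q}

variable {K}

theorem localComponent_le_component (P : E.Vertex → Prop) (Q : List E.Edge → Prop) (n : ℤ) :
    localComponent K P Q n ≤ component K E n := by
  refine Submodule.span_mono ?_
  rintro a ⟨x, y, z, p, q, -, -, -, -, h⟩
  exact ⟨x, y, z, p, q, h⟩

theorem localComponent_mono {P P' : E.Vertex → Prop} {Q Q' : List E.Edge → Prop}
    (hP : ∀ x, P x → P' x) (hQ : ∀ p, Q p → Q' p) (n : ℤ) :
    localComponent K P Q n ≤ localComponent K P' Q' n := by
  refine Submodule.span_mono ?_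
  rintro a ⟨x, y, z, p, q, hx, hy, hp, hq, h⟩
  exact ⟨x, y, z, p, q, hP _ hx, hP _ hy, hQ _ hp, hQ _ hq, h⟩

theorem localComponent_mul_eq_zero {P P' : E.Vertex → Prop} {Q Q' : List E.Edge → Prop}
    (h : ∀ x, P x → ¬ P' x) {m n : ℤ} {a b : LeavittPathAlgebra K E}
    (ha : a ∈ localComponent K P Q m) (hb : b ∈ localComponent K P' Q' n) : a * b = 0 := by
  refine Submodule.span_induction₂ (p := fun a b _ _ => a * b = 0) ?_ (by simp) (by simp)
    ?_ ?_ ?_ ?_ ha hb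
  · rintro _ _ ⟨x, y, z, p, q, hx, hy, -, -, -, hq, -, rfl⟩
      ⟨x', y', z', p', q', hx', hy', -, -, hp', -, -, rfl⟩
    rw [mul_assoc, ← mul_assoc (pathStar K y q),
      pathStar_mul_path_of_ne K hq hp' (fun e => h y hy (e ▸ hx')), zero_mul, mul_zero]
  · intro x y z _ _ _ h1 h2; rw [add_mul, h1, h2, add_zero]
  · intro x y z _ _ _ h1 h2; rw [mul_add, h1, h2, add_zero]
  · intro r x y _ _ h; rw [smul_mul_assoc, h, smul_zero]
  · intro r x y _ _ h; rw [mul_smul_comm, h, smul_zero]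

/-- After cancellation in the middle, a product keeps the outer vertices of its factors and extends
one path by a segment of another, so no new edges appear. -/
theorem localComponent_mul_mem {P : E.Vertex → Prop} {T : Set E.Edge} {m n : ℤ}
    {a b : LeavittPathAlgebra K E} (ha : a ∈ localComponent K P (fun p => ∀ e ∈ p, e ∈ T) m)
    (hb : b ∈ localComponent K P (fun p => ∀ e ∈ p, e ∈ T) n) :
    a * b ∈ localComponent K P (fun p => ∀ e ∈ p, e ∈ T) (m + n) := by
  refine Submodule.span_induction₂
    (p := fun a b _ _ => a * b ∈ localComponent K P (fun p => ∀ e ∈ p, e ∈ T) (m + n)) ?_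
    (by simp) (by simp) ?_ ?_ ?_ ?_ ha hb
  · rintro _ _ ⟨x, y, z, p, q, hx, hy, hpT, hqT, hp, hq, rfl, rfl⟩
      ⟨x', y', z', p', q', hx', hy', hpT', hqT', hp', hq', rfl, rfl⟩
    rw [mul_assoc, ← mul_assoc (pathStar K y q)]
    rcases pathStar_mul_path K hq hp' with h | ⟨s, rfl, hs, h⟩ | ⟨s, rfl, hs, h⟩
    · rw [h, zero_mul, mul_zero]; exact Submodule.zero_mem _
    · rw [h, ← mul_assoc, path_mul_path K hp hs]
      refine Submodule.subset_span ⟨x, y', z', p ++ s, q', hx, hy', ?_, hqT', hp.append hs, hq',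
        by simp; ring, rfl⟩
      intro e he
      rcases List.mem_append.1 he with he | he
      exacts [hpT e he, hpT' e (List.mem_append_right _ he)]
    · rw [h, pathStar_mul_pathStar K hq' hs]
      refine Submodule.subset_span ⟨x, y', z, p, q' ++ s, hx, hy', hpT, ?_, hp, hq'.append hs,
        by simp; ring, rfl⟩
      intro e he
      rcases List.mem_append.1 he with he | he
      exacts [hqT' e he, hqT e (List.mem_append_right _ he)]
  · intro x y z _ _ _ h1 h2; rw [add_mul]; exact Submodule.add_mem _ h1 h2
  · intro x y z _ _ _ h1 h2; rw [mul_add]; exact Submodule.add_mem _ h1 h2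
  · intro r x y _ _ h; rw [smul_mul_assoc]; exact Submodule.smul_mem _ r h
  · intro r x y _ _ h; rw [mul_smul_comm]; exact Submodule.smul_mem _ r h

/-- The graph may be infinite, but an element involves finitely many monomials. The vertices are
recorded separately because a path of length zero has no edges to determine it. -/
theorem exists_finite_localComponent {P : E.Vertex → Prop} {n : ℤ} {a : LeavittPathAlgebra K E}
    (ha : a ∈ localComponent K P (fun _ => True) n) : ∃ (X : Set E.Vertex) (T : Set E.Edge),
      X.Finite ∧ T.Finite ∧
        a ∈ localComponent K (fun x => P x ∧ x ∈ X) (fun p => ∀ e ∈ p, e ∈ T) n := by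
  induction ha using Submodule.span_induction with
  | mem a h =>
    obtain ⟨x, y, z, p, q, hx, hy, -, -, h⟩ := h
    refine ⟨{x, y}, {e | e ∈ p ++ q}, by simp, (p ++ q).finite_toSet, Submodule.subset_span
      ⟨x, y, z, p, q, ⟨hx, by simp⟩, ⟨hy, by simp⟩, fun e he => ?_, fun e he => ?_, h⟩⟩
    · exact List.mem_append_left _ he
    · exact List.mem_append_right _ he
  | zero => exact ⟨∅, ∅, Set.finite_empty, Set.finite_empty, Submodule.zero_mem _⟩
  | add a b _ _ iha ihb =>
    obtain ⟨X, T, hX, hT, h⟩ := iha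
    obtain ⟨X', T', hX', hT', h'⟩ := ihb
    refine ⟨X ∪ X', T ∪ T', hX.union hX', hT.union hT', Submodule.add_mem _ ?_ ?_⟩
    · exact localComponent_mono (fun x hx => ⟨hx.1, .inl hx.2⟩)
        (fun p hp e he => .inl (hp e he)) n h
    · exact localComponent_mono (fun x hx => ⟨hx.1, .inr hx.2⟩)
        (fun p hp e he => .inr (hp e he)) n h'
  | smul k a _ ih =>
    obtain ⟨X, T, hX, hT, h⟩ := ih
    exact ⟨X, T, hX, hT, Submodule.smul_mem _ k h⟩

theorem component_le_iSup_localComponent {ι : Type*} (lab : E.Vertex → ι)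
    (hlab : ∀ e, lab (E.rng e) = lab (E.src e)) (n : ℤ) :
    component K E n ≤ ⨆ i, localComponent K (fun x => lab x = i) (fun _ => True) n := by
  have hpath {x z : E.Vertex} {p : List E.Edge} (h : E.IsPath x p z) : lab x = lab z := by
    induction p generalizing x with
    | nil => rw [show x = z from h]
    | cons e p ih => rw [← ih h.2, hlab, h.1]
  refine Submodule.span_le.2 ?_
  rintro a ⟨x, y, z, p, q, hp, hq, h⟩
  exact Submodule.mem_iSup_of_mem (lab z) (Submodule.subset_span
    ⟨x, y, z, p, q, hpath hp, hpath hq, trivial, trivial, hp, hq, h⟩)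

/-- The homogeneous elements supported on an acyclic part of the graph are Drazin invertible. -/
theorem isDrazinIn_of_acyclic {P : E.Vertex → Prop} (hP : ∀ e, P (E.src e) → P (E.rng e))
    (hc : ∀ x c, P x → ¬ E.IsCycle x c) {n : ℤ} {a : LeavittPathAlgebra K E}
    (ha : a ∈ localComponent K P (fun _ => True) n) :
    IsDrazinIn ((component K E 0).map (Unitization.inrHom K K (LeavittPathAlgebra K E)))
      (a : Unitization K (LeavittPathAlgebra K E)) := by
  classical
  obtain ⟨X, T, hX, hT, h⟩ := exists_finite_localComponent ha
  set B := localComponent K (fun x => P x ∧ x ∈ X) (fun p => ∀ e ∈ p, e ∈ T) with hB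
  have hpow (k : ℕ) : ∃ b ∈ B ((k + 1 : ℕ) * n),
      (a : Unitization K (LeavittPathAlgebra K E)) ^ (k + 1) = b := by
    induction k with
    | zero => exact ⟨a, by simpa using h, by simp⟩
    | succ k ih =>
      obtain ⟨b, hb, hk⟩ := ih
      refine ⟨b * a, ?_, by rw [pow_succ, hk, Unitization.inr_mul]⟩
      have := localComponent_mul_mem hb h
      rwa [show ((k + 1 : ℕ) * n + n : ℤ) = ((k + 1 + 1 : ℕ) * n : ℤ) by push_cast; ring] at this
  -- A path with edges in `T` repeats none of them, so its length is at most `c`.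
  set c := hT.toFinset.card
  have hlen {x z : E.Vertex} {p : List E.Edge} (hx : P x) (hpT : ∀ e ∈ p, e ∈ T)
      (hp : E.IsPath x p z) : p.Nodup ∧ p.length ≤ c := by
    have hnd : p.Nodup := (hp.nodup_map_src hP hc hx).of_map _
    refine ⟨hnd, ?_⟩
    rw [← List.toFinset_card_of_nodup hnd]
    exact Finset.card_le_card fun e he => by simpa using hpT e (by simpa using he)
  by_cases hn : n = 0
  · subst hn
    have hLfin : {p : List E.Edge | (∀ e ∈ p, e ∈ T) ∧ p.length ≤ c}.Finite := by
      have := hT.to_subtype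
      refine ((List.finite_length_le T c).image (List.map Subtype.val)).subset ?_
      rintro p ⟨hp, hl⟩
      exact ⟨p.attach.map fun e => ⟨e.1, hp e.1 e.2⟩, by simpa using hl, by simp⟩
    have hfd : FiniteDimensional K (B 0) := by
      refine FiniteDimensional.span_of_finite K (((hX.prod hLfin).prod (hX.prod hLfin)).image
        (fun t => path K t.1.1 t.1.2 * pathStar K t.2.1 t.2.2) |>.subset ?_)
      rintro _ ⟨x, y, z, p, q, hx, hy, hpT, hqT, hp, hq, -, rfl⟩
      exact ⟨((x, p), (y, q)), ⟨⟨hx.2, hpT, (hlen hx.1 hpT hp).2⟩,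
        ⟨hy.2, hqT, (hlen hy.1 hqT hq).2⟩⟩, rfl⟩
    refine (IsDrazinIn.of_finiteDimensional
      (V := (B 0).map (Unitization.inrHom K K (LeavittPathAlgebra K E))) 1 (by simp) 1
      one_ne_zero fun k => ?_).mono (Submodule.map_mono (localComponent_le_component _ _ _))
    obtain ⟨b, hb, hk⟩ := hpow k
    rw [mul_zero] at hb
    exact ⟨b, hb, by simp [hk]⟩
  · refine .of_isNilpotent ⟨c + 1, ?_⟩
    obtain ⟨b, hb, hk⟩ := hpow c
    -- Monomials with paths of length at most `c` have degree between `-c` and `c`.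
    have hbot : B ((c + 1 : ℕ) * n) = ⊥ := by
      refine Submodule.span_eq_bot.2 ?_
      rintro _ ⟨x, y, z, p, q, hx, hy, hpT, hqT, hp, hq, hd, -⟩
      exfalso
      have h1 := (hlen hx.1 hpT hp).2
      have h2 := (hlen hy.1 hqT hq).2
      have h3 : (1 : ℤ) ≤ |n| := Int.one_le_abs hn
      have h5 : |(p.length : ℤ) - q.length| ≤ c := by rw [abs_le]; constructor <;> omega
      rw [hd, abs_mul, Nat.abs_cast] at h5
      have h6 := le_mul_of_one_le_right (Int.natCast_nonneg (c + 1)) h3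
      omega
    rw [hbot, Submodule.mem_bot] at hb
    rw [hk, hb, Unitization.inr_zero]

end LeavittPathAlgebra

/-! ### Graded matrix units over a finite orbit -/

section Shift

variable {K : Type*} [Field K] {A : Type*} [Ring A] [Algebra K A] {V : Type*}

/-- Orthogonal idempotents `P v`, permuted by partial isometries `O v` with inverses `G v`, are
permuted by a unit. -/
theorem exists_unit_of_partial_isometries [Fintype V] (σ : Equiv.Perm V) {P O G : V → A}
    (hPP : ∀ v, P v * P v = P v) (hP : ∀ v w, v ≠ w → P v * P w = 0)
    (hPO : ∀ v, P v * O v = O v) (hOP : ∀ v, O v * P (σ v) = O v)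
    (hPG : ∀ v, P (σ v) * G v = G v) (hGP : ∀ v, G v * P v = G v)
    (hGO : ∀ v, G v * O v = P (σ v)) (hOG : ∀ v, O v * G v = P v) :
    ∃ g : Aˣ, ∀ v, P v * g = O v ∧ g * P (σ v) = O v ∧ ((g⁻¹ : Aˣ) : A) * P v = G v := by
  classical
  have hOP0 {v w : V} (h : w ≠ σ v) : O v * P w = 0 := by
    rw [← hOP, mul_assoc, hP _ _ h.symm, mul_zero]
  have hPO0 {v w : V} (h : w ≠ v) : P w * O v = 0 := by
    rw [← hPO, ← mul_assoc, hP _ _ h, zero_mul]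
  have hGP0 {v w : V} (h : w ≠ v) : G v * P w = 0 := by
    rw [← hGP, mul_assoc, hP _ _ h.symm, mul_zero]
  have hOG0 {v w : V} (h : w ≠ v) : O v * G w = 0 := by
    rw [← hPG, ← mul_assoc, hOP0 (fun e => h (σ.injective e)), zero_mul]
  have hGO0 {v w : V} (h : w ≠ v) : G v * O w = 0 := by
    rw [← hPO, ← mul_assoc, hGP0 h, zero_mul]
  set p := ∑ v, P v with hp
  set s := ∑ v, O v with hs
  set t := ∑ v, G v with ht
  have hPs (v : V) : P v * s = O v := by
    rw [hs, Finset.mul_sum, Finset.sum_eq_single v (fun w _ h => hPO0 h.symm) (by simp), hPO]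
  have hsP (v : V) : s * P (σ v) = O v := by
    rw [hs, Finset.sum_mul, Finset.sum_eq_single v
      (fun w _ h => hOP0 (fun e => h (σ.injective e).symm)) (by simp), hOP]
  have hPp (v : V) : P v * p = P v := by
    rw [hp, Finset.mul_sum, Finset.sum_eq_single v (fun w _ h => hP _ _ h.symm) (by simp), hPP]
  have hpP (v : V) : p * P v = P v := by
    rw [hp, Finset.sum_mul, Finset.sum_eq_single v (fun w _ h => hP _ _ h) (by simp), hPP]
  have hpp : p * p = p := by
    nth_rw 1 [hp]; rw [Finset.sum_mul]; exact Finset.sum_congr rfl fun v _ => hPp v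
  have hps : p * s = s := by
    nth_rw 1 [hp]; rw [Finset.sum_mul]; exact Finset.sum_congr rfl fun v _ => hPs v
  have hsp : s * p = s := by
    rw [hp, ← Equiv.sum_comp σ, Finset.mul_sum]; exact Finset.sum_congr rfl fun v _ => hsP v
  have htp : t * p = t := by
    rw [ht, Finset.sum_mul]
    exact Finset.sum_congr rfl fun v _ => by rw [← hGP, mul_assoc, hPp]
  have hpt : p * t = t := by
    rw [ht, Finset.mul_sum]
    exact Finset.sum_congr rfl fun v _ => by rw [← hPG, ← mul_assoc, hpP]
  have hst : s * t = p := by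
    rw [hs, hp, Finset.sum_mul]
    refine Finset.sum_congr rfl fun v _ => ?_
    rw [ht, Finset.mul_sum, Finset.sum_eq_single v (fun w _ h => hOG0 h) (by simp), hOG]
  have hts : t * s = p := by
    rw [ht, hp, ← Equiv.sum_comp σ P, Finset.sum_mul]
    refine Finset.sum_congr rfl fun v _ => ?_
    rw [hs, Finset.mul_sum, Finset.sum_eq_single v (fun w _ h => hGO0 h) (by simp), hGO]
  -- `s` and `t` are mutually inverse in the corner of `p`; adding `1 - p` extends them by the
  -- identity.
  let g : Aˣ := ⟨s + (1 - p), t + (1 - p),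
    by simp only [mul_add, add_mul, mul_sub, sub_mul, mul_one, one_mul, hst, hsp, hpt, hpp]; abel,
    by simp only [mul_add, add_mul, mul_sub, sub_mul, mul_one, one_mul, hts, htp, hps, hpp]; abel⟩
  have h1 (v : V) : P v * g = O v := by
    change P v * (s + (1 - p)) = _
    rw [mul_add, mul_sub, hPs, hPp, mul_one, sub_self, add_zero]
  have h2 (v : V) : g * P (σ v) = O v := by
    change (s + (1 - p)) * P (σ v) = _
    rw [add_mul, sub_mul, hsP, hpP, one_mul, sub_self, add_zero]
  refine ⟨g, fun v => ⟨h1 v, h2 v, ?_⟩⟩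
  rw [← hOG, ← h2, mul_assoc, Units.inv_mul_cancel_left, hPG]

theorem mul_zpow_eq_of_mul_eq (σ : Equiv.Perm V) {P : V → A} {g : Aˣ}
    (h : ∀ v, P v * g = g * P (σ v)) (n : ℤ) (v : V) :
    P v * ((g ^ n : Aˣ) : A) = ((g ^ n : Aˣ) : A) * P ((σ ^ n) v) := by
  induction n generalizing v with
  | zero => simp
  | succ n ih =>
    rw [zpow_add_one, add_comm (n : ℤ) 1, zpow_one_add σ, Units.val_mul,
      ← mul_assoc, ih, mul_assoc, h, ← mul_assoc]
    rfl
  | pred n ih =>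
    have h' (w : V) : P w * ((g⁻¹ : Aˣ) : A) = ((g⁻¹ : Aˣ) : A) * P (σ⁻¹ w) := by
      rw [Units.eq_inv_mul_iff_mul_eq, ← mul_assoc, Units.mul_inv_eq_iff_eq_mul]
      simpa using (h (σ⁻¹ w)).symm
    rw [zpow_sub_one, sub_eq_add_neg, add_comm, zpow_add σ, zpow_neg_one, Units.val_mul,
      ← mul_assoc, ih, mul_assoc, h', ← mul_assoc]
    rfl

/-- Homogeneous elements of a skew Laurent extension of a finite-dimensional diagonal algebra, by
a permutation of finite order, are Drazin invertible. -/
theorem isDrazinIn_of_shift [Finite V] (σ : Equiv.Perm V) {P : V → A} {g : Aˣ}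
    (hPP : ∀ v, P v * P v = P v) (hP : ∀ v w, v ≠ w → P v * P w = 0)
    (h : ∀ v, P v * g = g * P (σ v)) {x d : A} {n : ℤ} (hd : d ∈ Submodule.span K (Set.range P))
    (hx : x = d * ((g ^ n : Aˣ) : A)) : IsDrazinIn (Submodule.span K (Set.range P)) x := by
  set D := Submodule.span K (Set.range P) with hD
  have hfd : FiniteDimensional K D := FiniteDimensional.span_of_finite K (Set.finite_range P)
  have hmul {a b : A} (ha : a ∈ D) (hb : b ∈ D) : a * b ∈ D := by
    refine (Submodule.span_mul_span K (Set.range P) (Set.range P)).trans_le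
      (Submodule.span_le.2 ?_) (Submodule.mul_mem_mul ha hb)
    rintro _ ⟨_, ⟨v, rfl⟩, _, ⟨w, rfl⟩, rfl⟩
    by_cases hvw : v = w
    · subst hvw
      simpa only [hPP] using Submodule.subset_span (Set.mem_range_self v)
    · simp only [hP v w hvw]; exact D.zero_mem
  have hconj (k : ℤ) {a : A} (ha : a ∈ D) :
      ∃ b ∈ D, ((g ^ k : Aˣ) : A) * a = b * ((g ^ k : Aˣ) : A) := by
    induction ha using Submodule.span_induction with
    | mem a h' =>
      obtain ⟨v, rfl⟩ := h'
      refine ⟨P ((σ ^ k)⁻¹ v), Submodule.subset_span (Set.mem_range_self _), ?_⟩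
      rw [mul_zpow_eq_of_mul_eq σ h]; simp
    | zero => exact ⟨0, D.zero_mem, by simp⟩
    | add a b _ _ iha ihb =>
      obtain ⟨a', ha', h1⟩ := iha
      obtain ⟨b', hb', h2⟩ := ihb
      exact ⟨a' + b', D.add_mem ha' hb', by rw [mul_add, add_mul, h1, h2]⟩
    | smul c a _ ih =>
      obtain ⟨a', ha', h1⟩ := ih
      exact ⟨c • a', D.smul_mem c ha', by rw [mul_smul_comm, smul_mul_assoc, h1]⟩
  have hpow (k : ℕ) : ∃ b ∈ D, x ^ (k + 1) = b * ((g ^ (n * (k + 1 : ℕ)) : Aˣ) : A) := by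
    induction k with
    | zero => exact ⟨d, hd, by simp [hx]⟩
    | succ k ih =>
      obtain ⟨b, hb, hk⟩ := ih
      obtain ⟨d', hd', hc⟩ := hconj (n * (k + 1 : ℕ)) hd
      refine ⟨b * d', hmul hb hd', ?_⟩
      rw [pow_succ, hk, hx, mul_assoc b, ← mul_assoc _ d, hc, mul_assoc d', ← mul_assoc b,
        ← Units.val_mul, ← zpow_add]
      congr 3
      push_cast; ring
  obtain ⟨M, hM⟩ := Nat.exists_eq_succ_of_ne_zero (orderOf_pos σ).ne'
  have hσ : σ ^ (M + 1) = 1 := by rw [← Nat.succ_eq_add_one, ← hM, pow_orderOf_eq_one]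
  obtain ⟨b, hb, hz⟩ := hpow M
  -- The exponent is a multiple of the order `M + 1` of `σ`, so `G` commutes with `D`, and it
  -- cancels the power of `g` in `x ^ (M + 1)`.
  set G : Aˣ := g ^ (-(n * (M + 1 : ℕ)))
  have hDG {a : A} (ha : a ∈ D) : Commute a (G : A) := by
    induction ha using Submodule.span_induction with
    | mem a h' =>
      obtain ⟨v, rfl⟩ := h'
      have := mul_zpow_eq_of_mul_eq σ h (-(n * (M + 1 : ℕ))) v
      rwa [show σ ^ (-(n * (M + 1 : ℕ))) = 1 by
        rw [← mul_neg_one, mul_right_comm, mul_comm, zpow_mul, zpow_natCast, hσ, one_zpow],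
        Equiv.Perm.one_apply] at this
    | zero => exact Commute.zero_left _
    | add a b _ _ iha ihb => exact iha.add_left ihb
    | smul c a _ ih => exact ih.smul_left c
  have hz' : x ^ (M + 1) * (G : A) = b := by
    rw [hz, mul_assoc, ← Units.val_mul, ← zpow_add]; simp
  refine IsDrazinIn.of_finiteDimensional G ?_ (M + 1) (by simp) fun k => ?_
  · rw [hx]
    refine (hDG hd).mul_left ?_
    change _ * _ = _ * _
    rw [← Units.val_mul, ← Units.val_mul, ← zpow_add, ← zpow_add, add_comm]
  · rw [hz']
    induction k with
    | zero => simpa using hb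
    | succ k ih => rw [pow_succ]; exact hmul ih hb

end Shift

/-! ### Isolated cycles -/

namespace LeavittPathAlgebra

variable {K : Type w} [Field K] {E : DirectedGraph.{u, v}}

/-- The homogeneous elements supported on an isolated cycle are Drazin invertible. -/
theorem isDrazinIn_of_cyclic {V : Type*} [Finite V] (σ : Equiv.Perm V) {ν : V → E.Vertex}
    (hν : Function.Injective ν) {o : V → E.Edge} (hsrc : ∀ v, E.src (o v) = ν v)
    (hrng : ∀ v, E.rng (o v) = ν (σ v)) (ho : ∀ v f, E.src f = ν v → f = o v)
    {P : E.Vertex → Prop} (hP : ∀ x, P x → ∃ v, ν v = x) {n : ℤ} {a : LeavittPathAlgebra K E}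
    (ha : a ∈ localComponent K P (fun _ => True) n) :
    IsDrazinIn ((component K E 0).map (Unitization.inrHom K K (LeavittPathAlgebra K E)))
      (a : Unitization K (LeavittPathAlgebra K E)) := by
  have := Fintype.ofFinite V
  set p : V → Unitization K (LeavittPathAlgebra K E) := fun v => (vertex K (ν v) :)
  have hpp (v : V) : p v * p v = p v := by
    simp only [p, ← Unitization.inr_mul, vertex_mul_self]
  have hp (v w : V) (h : v ≠ w) : p v * p w = 0 := by
    simp only [p, ← Unitization.inr_mul, vertex_mul_of_ne K (hν.ne h), Unitization.inr_zero]
  obtain ⟨g, hg⟩ := exists_unit_of_partial_isometries σ (P := p)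
    (O := fun v => (edge K (o v) :)) (G := fun v => (ghost K (o v) :)) hpp hp
    (fun v => by simp only [p, ← Unitization.inr_mul, ← hsrc, src_mul_edge])
    (fun v => by simp only [p, ← Unitization.inr_mul, ← hrng, edge_mul_rng])
    (fun v => by simp only [p, ← Unitization.inr_mul, ← hrng, rng_mul_ghost])
    (fun v => by simp only [p, ← Unitization.inr_mul, ← hsrc, ghost_mul_src])
    (fun v => by simp only [p, ← Unitization.inr_mul, ← hrng, ghost_mul_edge_self])
    (fun v => by
      simp only [p, ← Unitization.inr_mul, ← hsrc]
      rw [edge_mul_ghost_of_unique K _ fun f hf => ho v f (hf.trans (hsrc v))])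
  have hpg (v : V) : p v * g = g * p (σ v) := (hg v).1.trans (hg v).2.1.symm
  have hpath {x z : E.Vertex} {l : List E.Edge} (hl : E.IsPath x l z) (v : V) (hv : ν v = x) :
      (path K x l : Unitization K (LeavittPathAlgebra K E)) =
        p v * ((g ^ (l.length : ℤ) : Units _) : Unitization K (LeavittPathAlgebra K E)) := by
    induction l generalizing x v with
    | nil => simp [path, p, hv]
    | cons e l ih =>
      obtain rfl := ho v e (hl.1.trans hv.symm)
      rw [path, Unitization.inr_mul, ih hl.2 (σ v) (hrng v).symm, ← (hg v).1, mul_assoc,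
        ← mul_assoc (g : Unitization K (LeavittPathAlgebra K E)), ← hpg, ← mul_assoc, ← mul_assoc,
        hpp, mul_assoc, ← Units.val_mul, ← zpow_one_add]
      simp [add_comm]
  have hpathStar {x z : E.Vertex} {l : List E.Edge} (hl : E.IsPath x l z) (v : V)
      (hv : ν v = x) : (pathStar K x l : Unitization K (LeavittPathAlgebra K E)) =
        ((g ^ (-(l.length : ℤ)) : Units _) : Unitization K (LeavittPathAlgebra K E)) * p v := by
    induction l generalizing x v with
    | nil => simp [pathStar, p, hv]
    | cons e l ih =>
      obtain rfl := ho v e (hl.1.trans hv.symm)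
      rw [pathStar, Unitization.inr_mul, ih hl.2 (σ v) (hrng v).symm, mul_assoc]
      have : p (σ v) * (ghost K (o v) : Unitization K (LeavittPathAlgebra K E)) =
          (ghost K (o v) :) := by simp only [p, ← Unitization.inr_mul, ← hrng, rng_mul_ghost]
      rw [this, ← (hg v).2.2, ← mul_assoc, ← Units.val_mul, ← zpow_sub_one]
      congr 3
      simp; ring
  have hmem : ∃ d ∈ Submodule.span K (Set.range p), (a : Unitization K (LeavittPathAlgebra K E)) =
      d * ((g ^ n : Units _) : Unitization K (LeavittPathAlgebra K E)) := by
    induction ha using Submodule.span_induction with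
    | mem a h =>
      obtain ⟨x, y, z, l, l', hx, hy, -, -, hl, hl', rfl, rfl⟩ := h
      obtain ⟨v, rfl⟩ := hP x hx
      obtain ⟨v', rfl⟩ := hP y hy
      set n : ℤ := l.length - l'.length
      -- Moving `p v'` to the left past `g ^ n` turns it into `p w`. The product `p v * p w` lies in
      -- the span whether or not `v = w`, so the common range of the paths is not needed.
      set w := (σ ^ n)⁻¹ v'
      have hw : p v' = p ((σ ^ n) w) := by simp [w]
      refine ⟨p v * p w, ?_, ?_⟩
      · by_cases hvw : v = w
        · rw [← hvw, hpp]; exact Submodule.subset_span (Set.mem_range_self v)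
        · rw [hp _ _ hvw]; exact Submodule.zero_mem _
      · rw [Unitization.inr_mul, hpath hl v rfl, hpathStar hl' v' rfl, mul_assoc,
          ← mul_assoc _ _ (p v'), ← Units.val_mul, ← zpow_add, ← sub_eq_add_neg, hw,
          ← mul_zpow_eq_of_mul_eq σ hpg, mul_assoc]
    | zero => exact ⟨0, Submodule.zero_mem _, by simp⟩
    | add a b _ _ iha ihb =>
      obtain ⟨a', ha', h1⟩ := iha
      obtain ⟨b', hb', h2⟩ := ihb
      exact ⟨a' + b', Submodule.add_mem _ ha' hb', by rw [Unitization.inr_add, add_mul, h1, h2]⟩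
    | smul c a _ ih =>
      obtain ⟨a', ha', h1⟩ := ih
      exact ⟨c • a', Submodule.smul_mem _ c ha', by
        rw [Unitization.inr_smul, smul_mul_assoc, h1]⟩
  obtain ⟨d, hd, hx⟩ := hmem
  refine (isDrazinIn_of_shift σ hpp hp hpg hd hx).mono (Submodule.span_le.2 ?_)
  rintro _ ⟨v, rfl⟩
  exact ⟨vertex K (ν v), vertex_mem_component _, rfl⟩

end LeavittPathAlgebra

/-! ### Single cycles and disjoint unions of graphs -/

namespace DirectedGraph

variable {E : DirectedGraph.{u, v}}

theorem IsPath.mem_map_rng {x y z : E.Vertex} {p : List E.Edge} (hp : E.IsPath x p y)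
    (hz : z ∈ p.map E.src) : z = x ∨ z ∈ p.map E.rng := by
  induction p generalizing x with
  | nil => simp at hz
  | cons e p ih =>
    rw [List.map_cons, List.mem_cons] at hz ⊢
    rcases hz with rfl | hz
    · exact .inl hp.1
    · exact .inr (ih hp.2 hz)

theorem IsPath.end_mem_map_rng {x y : E.Vertex} {p : List E.Edge} (hp : E.IsPath x p y)
    (h : p ≠ []) : y ∈ p.map E.rng := by
  induction p generalizing x with
  | nil => exact absurd rfl h
  | cons e p ih =>
    by_cases hp0 : p = []
    · subst hp0; simp [show E.rng e = y from hp.2]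
    · exact List.mem_cons_of_mem _ (ih hp.2 hp0)

/-- In a graph consisting of a single cycle, the cycle induces a permutation of the vertices. -/
theorem IsSingleCycle.exists_perm (h : E.IsSingleCycle) : Finite E.Vertex ∧
    ∃ (σ : Equiv.Perm E.Vertex) (o : E.Vertex → E.Edge), (∀ x, E.src (o x) = x) ∧
      (∀ x, E.rng (o x) = σ x) ∧ ∀ x f, E.src f = x → f = o x := by
  obtain ⟨x, c, ⟨hc, hp, hnd⟩, hV, hE⟩ := h
  have hfin : Finite E.Vertex := Set.finite_univ_iff.1
    ((c.map E.src).finite_toSet.subset fun y _ => hV y)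
  have hinj : Function.Injective E.src := fun e f hef =>
    List.inj_on_of_nodup_map hnd (hE e) (hE f) hef
  have hsurj : Function.Surjective E.rng := fun y => by
    have : y ∈ c.map E.rng := by
      rcases hp.mem_map_rng (hV y) with rfl | h
      exacts [hp.end_mem_map_rng hc, h]
    obtain ⟨e, -, he⟩ := List.mem_map.1 this
    exact ⟨e, he⟩
  choose o ho using fun y => List.mem_map.1 (hV y)
  have ho' (f : E.Edge) : f = o (E.src f) := hinj (ho _).2.symm
  -- Every vertex of a closed path is the range of some edge, so the successor map is onto, hence
  -- bijective on a finite set.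
  have hbij : Function.Bijective fun y => E.rng (o y) := by
    refine Function.Surjective.bijective_of_finite fun y => ?_
    obtain ⟨f, rfl⟩ := hsurj y
    exact ⟨E.src f, by rw [← ho' f]⟩
  exact ⟨hfin, Equiv.ofBijective _ hbij, o, fun y => (ho y).2, fun y => rfl,
    fun y f hf => hf ▸ ho' f⟩

variable {ι : Type*} {F : ι → DirectedGraph.{u', v'}}

/-- The inclusion of the vertices of a graph into a disjoint union. -/
def ofVertex (F : ι → DirectedGraph.{u', v'}) (i : ι) (x : (F i).Vertex) :
    (disjointUnion F).Vertex :=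
  Sigma.mk i x

/-- The inclusion of the edges of a graph into a disjoint union. -/
def ofEdge (F : ι → DirectedGraph.{u', v'}) (i : ι) (e : (F i).Edge) : (disjointUnion F).Edge :=
  Sigma.mk i e

/-- The index of the graph to which a vertex of a disjoint union belongs. -/
def index (x : (disjointUnion F).Vertex) : ι := Sigma.fst x

theorem ofVertex_injective (i : ι) : Function.Injective (ofVertex F i) :=
  fun _ _ h => eq_of_heq (Sigma.mk.inj h).2

@[simp] theorem index_ofVertex (i : ι) (x : (F i).Vertex) : index (ofVertex F i x) = i := rfl

@[simp] theorem src_ofEdge (i : ι) (e : (F i).Edge) :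
    (disjointUnion F).src (ofEdge F i e) = ofVertex F i ((F i).src e) := rfl

@[simp] theorem rng_ofEdge (i : ι) (e : (F i).Edge) :
    (disjointUnion F).rng (ofEdge F i e) = ofVertex F i ((F i).rng e) := rfl

theorem exists_eq_ofVertex (x : (disjointUnion F).Vertex) :
    ∃ (i : ι) (y : (F i).Vertex), x = ofVertex F i y := ⟨x.1, x.2, rfl⟩

theorem exists_eq_ofEdge (e : (disjointUnion F).Edge) :
    ∃ (i : ι) (f : (F i).Edge), e = ofEdge F i f := ⟨e.1, e.2, rfl⟩

theorem Iso.index_rng (φ : Iso E (disjointUnion F)) (e : E.Edge) :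
    index (φ.onVertex (E.rng e)) = index (φ.onVertex (E.src e)) := by
  rw [← φ.rng_onEdge, ← φ.src_onEdge]
  obtain ⟨i, f, h⟩ := exists_eq_ofEdge (φ.onEdge e)
  rw [h]; rfl

/-- An edge never leaves its member of the union, so a path stays in the graph in which it starts.
-/
theorem Iso.exists_isPath (φ : Iso E (disjointUnion F)) {i : ι} {x y : E.Vertex}
    {p : List E.Edge} (hp : E.IsPath x p y) (x' : (F i).Vertex)
    (hx : φ.onVertex x = ofVertex F i x') :
    ∃ (p' : List (F i).Edge) (y' : (F i).Vertex), φ.onVertex y = ofVertex F i y' ∧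
      p.map φ.onEdge = p'.map (ofEdge F i) ∧ (F i).IsPath x' p' y' := by
  induction p generalizing x x' with
  | nil => obtain rfl : x = y := hp; exact ⟨[], x', hx, rfl, rfl⟩
  | cons e p ih =>
    obtain ⟨rfl, hp⟩ := hp
    have h1 := φ.src_onEdge e
    have h2 := φ.rng_onEdge e
    obtain ⟨j, e', he⟩ := exists_eq_ofEdge (φ.onEdge e)
    rw [he, src_ofEdge, hx] at h1
    rw [he, rng_ofEdge] at h2
    obtain rfl : j = i := congrArg index h1
    obtain ⟨p', y', hy, hpp, hpath⟩ := ih hp _ h2.symm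
    exact ⟨e' :: p', y', hy, by rw [List.map_cons, List.map_cons, he, hpp],
      ofVertex_injective _ h1, hpath⟩

theorem Iso.not_isCycle (φ : Iso E (disjointUnion F)) {i : ι} (hi : (F i).IsAcyclic)
    {x : E.Vertex} (hx : index (φ.onVertex x) = i) (c : List E.Edge) : ¬ E.IsCycle x c := by
  rintro ⟨hc, hp, hnd⟩
  obtain ⟨j, x', hx'⟩ := exists_eq_ofVertex (φ.onVertex x)
  obtain rfl : j = i := by rw [← hx, hx', index_ofVertex]
  obtain ⟨p', y', hy, hpp, hpath⟩ := φ.exists_isPath hp _ hx'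
  obtain rfl : x' = y' := ofVertex_injective _ (hx'.symm.trans hy)
  refine hi _ p' ⟨?_, hpath, ?_⟩
  · rintro rfl; exact hc (List.map_eq_nil_iff.1 hpp)
  · have h1 : (c.map E.src).map φ.onVertex = (p'.map (F j).src).map (ofVertex F j) := by
      calc (c.map E.src).map φ.onVertex = (c.map φ.onEdge).map (disjointUnion F).src := by
            simp [φ.src_onEdge]
        _ = _ := by rw [hpp, List.map_map, List.map_map]; rfl
    have h2 := hnd.map φ.onVertex.injective
    rw [h1] at h2
    exact h2.of_map _

end DirectedGraph

/-! ### Assembling the members of the union -/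

open LeavittPathAlgebra DirectedGraph in
/-- Homogeneous elements supported on one graph of a disjoint union of acyclic graphs and single
cycles are Drazin invertible. -/
theorem isDrazinIn_of_index {K : Type w} [Field K] {ι : Type*} {E : DirectedGraph.{u, v}}
    {F : ι → DirectedGraph.{u', v'}} (φ : Iso E (disjointUnion F)) {i : ι}
    (hi : (F i).IsAcyclic ∨ (F i).IsSingleCycle) {n : ℤ} {a : LeavittPathAlgebra K E}
    (ha : a ∈ localComponent K (fun x => index (φ.onVertex x) = i) (fun _ => True) n) :
    IsDrazinIn ((component K E 0).map (Unitization.inrHom K K (LeavittPathAlgebra K E)))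
      (a : Unitization K (LeavittPathAlgebra K E)) := by
  rcases hi with hi | hi
  · exact isDrazinIn_of_acyclic (fun e he => (φ.index_rng e).trans he)
      (fun x c hx => φ.not_isCycle hi hx c) ha
  · obtain ⟨hfin, σ, o, ho, hoσ, huniq⟩ := hi.exists_perm
    refine isDrazinIn_of_cyclic σ (ν := fun x => φ.onVertex.symm (ofVertex F i x))
      (o := fun x => φ.onEdge.symm (ofEdge F i (o x))) ?_ (fun x => ?_) (fun x => ?_)
      (fun x f hf => ?_) (fun x hx => ?_) ha
    · exact φ.onVertex.symm.injective.comp (ofVertex_injective i)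
    · rw [Equiv.eq_symm_apply, ← φ.src_onEdge, Equiv.apply_symm_apply, src_ofEdge, ho]
    · rw [Equiv.eq_symm_apply, ← φ.rng_onEdge, Equiv.apply_symm_apply, rng_ofEdge, hoσ]
    · rw [Equiv.eq_symm_apply, ← φ.src_onEdge] at hf
      rw [Equiv.eq_symm_apply]
      obtain ⟨j, e, he⟩ := exists_eq_ofEdge (φ.onEdge f)
      rw [he, src_ofEdge] at hf
      obtain rfl : j = i := congrArg index hf
      rw [he, huniq x e (ofVertex_injective _ hf)]
    · obtain ⟨j, y, hy⟩ := exists_eq_ofVertex (φ.onVertex x)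
      obtain rfl : j = i := by rw [← hx, hy, index_ofVertex]
      exact ⟨y, by rw [← hy, Equiv.symm_apply_apply]⟩

open LeavittPathAlgebra DirectedGraph in
/-- Homogeneous elements of the Leavitt path algebra of a disjoint union of acyclic graphs and
single cycles are Drazin invertible. -/
theorem isDrazinIn_of_mem_component {K : Type w} [Field K] {ι : Type*} {E : DirectedGraph.{u, v}}
    {F : ι → DirectedGraph.{u', v'}} (φ : Iso E (disjointUnion F))
    (hF : ∀ i, (F i).IsAcyclic ∨ (F i).IsSingleCycle) {n : ℤ} {a : LeavittPathAlgebra K E}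
    (ha : a ∈ component K E n) :
    IsDrazinIn ((component K E 0).map (Unitization.inrHom K K (LeavittPathAlgebra K E)))
      (a : Unitization K (LeavittPathAlgebra K E)) := by
  -- The index is constant along edges, so the element is a finite sum of pieces on different
  -- graphs, which are pairwise orthogonal.
  obtain ⟨f, hf, rfl⟩ := (Submodule.mem_iSup_iff_exists_finsupp _ _).1
    (component_le_iSup_localComponent (fun x => index (φ.onVertex x)) φ.index_rng n ha)
  rw [Finsupp.sum, ← Unitization.inrHom_apply (S := K) (R := K), map_sum]
  refine IsDrazinIn.sum _ _ (fun i _ => isDrazinIn_of_index φ (hF i) (hf i)) fun i _ j _ hij => ?_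
  rw [Unitization.inrHom_apply, Unitization.inrHom_apply, ← Unitization.inr_mul,
    localComponent_mul_eq_zero (fun x hx hx' => hij (hx.symm.trans hx')) (hf i) (hf j),
    Unitization.inr_zero]

theorem proposition4p7 {K : Type w} [Field K] {ι : Type*} (E : DirectedGraph.{u, v})
    (F : ι → DirectedGraph.{u', v'}) (φ : DirectedGraph.Iso E (DirectedGraph.disjointUnion F))
    (hF : ∀ i, (F i).IsAcyclic ∨ (F i).IsSingleCycle) :
    IsGradedExchange (LeavittPathAlgebra.component K E) := by
  exact isGradedExchange_of_isDrazinIn _ fun _ _ ha => isDrazinIn_of_mem_component φ hF ha
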